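/- Let $X_2=\{1,2\}\times\mathbb N$ with $\mathbb N=\{1,2,\dots\}$ (two rays of discrete points). Houghton's group $\mathcal H_2$ is the group of all bijections $g$ of $X_2$ for which there are $(m_1,m_2)\in\mathbb Z^2$ and a finite set $K_g\subset X_2$ with $g(k,p)=(k,p+m_k)$ for all $(k,p)\in X_2\setminus K_g$. Let $g_2\in\mathcal H_2$ be the translation given by $(1,p)\mapsto(1,p-1)$ for $p\ge 2$, $(1,1)\mapsto(2,1)$, $(2,p)\mapsto(2,p+1)$, and let $\alpha\in\mathcal H_2$ be the transposition of $(1,1)$ and $(1,2)$. For a group $G$ with a finite generating set $A$, let $|g|$ be the word length of $g\in G$ over $A\cup A^{-1}$, and let the growth rate of an endomorphism $\phi:G\to G$ be $$\mathrm{GR}(\phi)=\sup\Big\{\limsup_{k\to\infty}|\phi^k(g)|^{1/k} : g\in G\Big\}.$$ **Theorem.** The group $\mathcal H_2$ is generated by $\{g_2,\alpha\}$, and every automorphism $\phi$ of $\mathcal H_2$ satisfies $\mathrm{GR}(\phi)=1$, where the growth rate may be computed with respect to any finite generating set of $\mathcal H_2$. -/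

import Mathlib

open scoped ENNReal

/-- A permutation `g` of `X_n = {1, …, n} × ℕ` (`n` rays) is an *eventual translation* if, outside a
finite set, it acts on the `k`-th ray as the translation by some integer `m k`.  Positions along a
ray are counted from `0`, so that `(k, p)` is the point at distance `p + 1` from the origin. -/
def IsEventualTranslation {n : ℕ} (g : Equiv.Perm (Fin n × ℕ)) : Prop :=
  ∃ m : Fin n → ℤ, ∃ K : Set (Fin n × ℕ), K.Finite ∧
    ∀ x : Fin n × ℕ, x ∉ K → (g x).1 = x.1 ∧ ((g x).2 : ℤ) = (x.2 : ℤ) + m x.1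

/-- Houghton's group `H_n`: the group of all eventual translations of `X_n`. -/
def Houghton (n : ℕ) : Subgroup (Equiv.Perm (Fin n × ℕ)) where
  carrier := {g | IsEventualTranslation g}
  one_mem' := ⟨fun _ => 0, ∅, Set.finite_empty, fun x _ => by simp⟩
  mul_mem' := by
    rintro g h ⟨m, K, hK, hg⟩ ⟨m', K', hK', hh⟩
    refine ⟨fun k => m k + m' k, K' ∪ h ⁻¹' K, hK'.union (hK.preimage h.injective.injOn), ?_⟩
    intro x hx
    rw [Set.mem_union, not_or] at hx
    obtain ⟨h1, h2⟩ := hh x hx.1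
    obtain ⟨h3, h4⟩ := hg (h x) hx.2
    refine ⟨by rw [Equiv.Perm.mul_apply, h3, h1], ?_⟩
    rw [Equiv.Perm.mul_apply, h4, h2, h1]
    ring
  inv_mem' := by
    rintro g ⟨m, K, hK, hg⟩
    refine ⟨fun k => - m k, g '' K, hK.image g, ?_⟩
    intro x hx
    have hgx : g (g⁻¹ x) = x := g.apply_symm_apply x
    have hx1 : g⁻¹ x ∉ K := fun hmem => hx ⟨g⁻¹ x, hmem, hgx⟩
    obtain ⟨h1, h2⟩ := hg (g⁻¹ x) hx1
    rw [hgx] at h1 h2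
    refine ⟨h1.symm, ?_⟩
    rw [h2, h1]
    ring

/-- The permutation of `X_2` that translates by one step along the line formed by the two rays,
from the first ray towards the second one. -/
def translationPerm : Equiv.Perm (Fin 2 × ℕ) where
  toFun
    | (0, 0) => (1, 0)
    | (0, p + 1) => (0, p)
    | (1, p) => (1, p + 1)
  invFun
    | (1, 0) => (0, 0)
    | (1, p + 1) => (1, p)
    | (0, p) => (0, p + 1)
  left_inv := by
    rintro ⟨i, p⟩
    fin_cases i <;> cases p <;> rfl
  right_inv := by
    rintro ⟨i, p⟩
    fin_cases i <;> cases p <;> rfl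

/-- The element `g_2` of `H_2`. -/
def houghtonG2 : Houghton 2 :=
  ⟨translationPerm, ![-1, 1], {(0, 0)}, Set.finite_singleton _, by
    rintro ⟨i, p⟩ hx
    fin_cases i
    · cases p with
      | zero => exact absurd rfl hx
      | succ p => simp [translationPerm]
    · simp [translationPerm]⟩

/-- The element `α` of `H_2`: the transposition of the first two points of the first ray. -/
def houghtonAlpha : Houghton 2 :=
  ⟨Equiv.swap (0, 0) (0, 1), fun _ => 0, {(0, 0), (0, 1)}, Set.toFinite _, by
    intro x hx
    simp only [Set.mem_insert_iff, Set.mem_singleton_iff, not_or] at hx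
    simp [Equiv.swap_apply_of_ne_of_ne hx.1 hx.2]⟩

/-- Word length of `g` with respect to `A`: the least length of a word over `A ∪ A⁻¹` that
represents `g` (such words exist for every `g` as soon as `A` generates the group). -/
noncomputable def wordLength {G : Type*} [Group G] (A : Set G) (g : G) : ℕ :=
  sInf {k : ℕ | ∃ w : List G, (∀ x ∈ w, x ∈ A ∨ x⁻¹ ∈ A) ∧ w.prod = g ∧ w.length = k}

/-- Growth rate of an endomorphism `φ` with respect to the generating set `A`:
the supremum over `g` of `limsup |φ^k(g)|^(1/k)`.  It is taken in `[0, ∞]`, where suprema and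
upper limits always exist. -/
noncomputable def growthRate {G : Type*} [Group G] (A : Set G) (φ : G →* G) : ℝ≥0∞ :=
  ⨆ g : G, Filter.limsup
    (fun k : ℕ => (wordLength A (φ^[k] g) : ℝ≥0∞) ^ (1 / (k : ℝ))) Filter.atTop

/-! The square of every automorphism `φ` is inner (`exists_sq_eq_conj`), so two iterations lengthen
a word by at most a constant, orbits grow at most linearly and the growth rate is at most `1`. It is
at least `1` because `φ` is injective and some `g ≠ 1` exists.

Transpositions are singled out inside the group by algebraic conditions
(`isSwap_iff_of_forall_involution`), so `φ` permutes them and is conjugation by a permutation `f` of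
the points (`exists_perm_forall_mulEquiv_apply`). With the rays glued to a line, `houghtonG2` is `x
↦ x + 1`. As `f` and `f⁻¹` conjugate it to eventual translations, `f` is affine of slope `±1` near
each end, with the same sign at both by injectivity. So `f` may reflect the line, but `f * f` lies
in the group (`isTranslationNearEnds_sq`).

For generation, the shifts at the two ends agree (`shift_eq_shift`), so a power of `houghtonG2`
reduces any element to finite support, and conjugating `houghtonAlpha` gives all adjacent
transpositions. -/

/-! ### Transpositions and automorphisms of permutation groups -/

section Swaps

open Equiv Equiv.Perm

variable {X : Type*} [DecidableEq X]

theorem Equiv.Perm.IsSwap.eq_swap_of_ne {s : Perm X} (hs : s.IsSwap) {a b : X} (hab : a ≠ b)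
    (ha : s a ≠ a) (hb : s b ≠ b) : s = swap a b := by
  obtain ⟨u, v, huv, rfl⟩ := hs
  have h1 : a = u ∨ a = v := by
    by_contra! h
    exact ha (swap_apply_of_ne_of_ne h.1 h.2)
  have h2 : b = u ∨ b = v := by
    by_contra! h
    exact hb (swap_apply_of_ne_of_ne h.1 h.2)
  rcases h1 with rfl | rfl <;> rcases h2 with rfl | rfl
  · exact absurd rfl hab
  · rfl
  · exact swap_comm _ _
  · exact absurd rfl hab

theorem Equiv.Perm.IsSwap.exists_eq_swap_of_ne {s : Perm X} (hs : s.IsSwap) {a : X} (ha : s a ≠ a) :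
    ∃ b, b ≠ a ∧ s = swap a b :=
  ⟨s a, ha, hs.eq_swap_of_ne ha.symm ha fun h => ha (s.injective h)⟩

theorem commute_swap_of_apply_eq {s : Perm X} {a b : X} (ha : s a = a) (hb : s b = b) :
    Commute s (swap a b) := by
  have h := swap_apply_apply s a b
  rw [ha, hb] at h
  exact (eq_mul_inv_iff_mul_eq.mp h).symm

/-- Two transpositions that do not commute share exactly one point. -/
theorem Equiv.Perm.IsSwap.exists_common_point {s t : Perm X} (hs : s.IsSwap) (ht : t.IsSwap)
    (hst : ¬ Commute s t) :
    ∃ a b c, b ≠ a ∧ c ≠ a ∧ b ≠ c ∧ s = swap a b ∧ t = swap a c := by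
  obtain ⟨u, v, huv, rfl⟩ := ht
  have key : ∃ a c, a ≠ c ∧ swap u v = swap a c ∧ s a ≠ a := by
    by_cases hu : s u = u
    · by_cases hv : s v = v
      · exact absurd (commute_swap_of_apply_eq hu hv) hst
      · exact ⟨v, u, huv.symm, swap_comm _ _, hv⟩
    · exact ⟨u, v, huv, rfl, hu⟩
  obtain ⟨a, c, hac, h, ha⟩ := key
  obtain ⟨b, hb, rfl⟩ := hs.exists_eq_swap_of_ne ha
  refine ⟨a, b, c, hb, hac.symm, ?_, rfl, h⟩
  rintro rfl
  exact hst (h ▸ Commute.refl _)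

/-- The only point moved by both transpositions is the common one; this recovers maps on points from
their effect on transpositions. -/
theorem eq_of_swap_eq_swap {a b c a' b' c' : X} (hab : a ≠ b) (hbc : b ≠ c) (hac : a ≠ c)
    (h1 : swap a b = swap a' b') (h2 : swap a c = swap a' c') : a = a' := by
  by_contra h
  have e1 : swap a' b' a = b := by rw [← h1, swap_apply_left]
  have e2 : swap a' c' a = c := by rw [← h2, swap_apply_left]
  have e3 : a = b' := by
    by_contra h'
    exact hab (by rw [← e1, swap_apply_of_ne_of_ne h h'])
  have e4 : a = c' := by
    by_contra h'
    exact hac (by rw [← e2, swap_apply_of_ne_of_ne h h'])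
  rw [← e3, swap_apply_right] at e1
  rw [← e4, swap_apply_right] at e2
  exact hbc (e1.symm.trans e2)

theorem swap_mul_swap_pow_six (a b c d : X) : (swap a b * swap c d) ^ 6 = 1 := by
  rcases eq_or_ne a b with rfl | hab
  · rw [swap_self, ← Perm.one_def, one_mul, show 6 = 2 * 3 from rfl, pow_mul, sq, swap_mul_self, one_pow]
  rcases eq_or_ne c d with rfl | hcd
  · rw [swap_self, ← Perm.one_def, mul_one, show 6 = 2 * 3 from rfl, pow_mul, sq, swap_mul_self, one_pow]
  by_cases h : Commute (swap a b) (swap c d)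
  · rw [h.mul_pow, show 6 = 2 * 3 from rfl, pow_mul, pow_mul, sq, sq, swap_mul_self,
      swap_mul_self, one_pow, one_mul]
  · obtain ⟨u, v, w, hv, hw, hvw, h1, h2⟩ :=
      IsSwap.exists_common_point ⟨a, b, hab, rfl⟩ ⟨c, d, hcd, rfl⟩ h
    rw [h1, h2]
    have h3 : (swap u v * swap u w) ^ 3 = 1 := by
      ext x
      simp only [pow_succ, pow_zero, one_mul, Perm.mul_apply, swap_apply_def, Perm.one_apply]
      grind
    rw [show 6 = 3 * 2 from rfl, pow_mul, h3, one_pow]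

/-- Among the involutions of a group that contains all transpositions and whose involutions have
fixed points, the transpositions are those whose products with their conjugates have order
dividing `6`. -/
theorem isSwap_iff_of_forall_involution {G : Subgroup (Perm X)} (hG : ∀ x y, swap x y ∈ G)
    (hfix : ∀ t ∈ G, t * t = 1 → ∃ x, t x = x) {t : Perm X} (ht : t ∈ G) :
    t.IsSwap ↔ t ≠ 1 ∧ t * t = 1 ∧ ∀ g ∈ G, (t * (g * t * g⁻¹)) ^ 6 = 1 := by
  constructor
  · rintro ⟨a, b, hab, rfl⟩
    refine ⟨fun h => hab (swap_eq_one_iff.mp h), swap_mul_self _ _, fun g _ => ?_⟩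
    rw [← swap_apply_apply]
    exact swap_mul_swap_pow_six _ _ _ _
  · rintro ⟨h1, h2, h3⟩
    obtain ⟨e, he⟩ := hfix t ht h2
    have inv : ∀ x, t (t x) = x := fun x => by rw [← Perm.mul_apply, h2, Perm.one_apply]
    obtain ⟨a, ha⟩ : ∃ a, t a ≠ a := by
      by_contra! h
      exact h1 (Perm.ext h)
    by_contra hs
    obtain ⟨c, hc, hca, hcb⟩ : ∃ c, t c ≠ c ∧ c ≠ a ∧ c ≠ t a := by
      by_contra! h
      refine hs ⟨a, t a, ha.symm, Perm.ext fun x => ?_⟩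
      by_cases hxa : x = a
      · rw [hxa, swap_apply_left]
      by_cases hxb : x = t a
      · rw [hxb, swap_apply_right, inv]
      rw [swap_apply_of_ne_of_ne hxa hxb]
      by_contra hx
      exact hxb (h x hx hxa)
    -- With two moved pairs and a fixed point `e`, this conjugator makes the product a 5-cycle on
    -- `a, c, e, d, b` (where `b = t a`, `d = t c`), so its sixth power still moves `a`.
    have h6 := h3 (swap a c * swap (t a) e) (G.mul_mem (hG _ _) (hG _ _))
    have h7 := DFunLike.congr_fun h6 a
    have hae : a ≠ e := by rintro rfl; exact ha he
    have hce : c ≠ e := by rintro rfl; exact hc he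
    have hbe : t a ≠ e := by intro h; apply hae; rw [← inv a, h, he]
    have hde : t c ≠ e := by intro h; apply hce; rw [← inv c, h, he]
    have hda : t c ≠ a := by intro h; apply hcb; rw [← h, inv]
    have hdb : t c ≠ t a := fun h => hca (t.injective h)
    set b := t a with hb
    set d := t c with hd
    have hta : t b = a := inv a
    have htc : t d = c := inv c
    set s := t * (swap a c * swap b e * t * (swap a c * swap b e)⁻¹) with hsdef
    have hsx : ∀ x, s x = t (swap a c (swap b e (t (swap b e (swap a c x))))) := by
      intro x
      simp [hsdef, Perm.mul_apply]
    have s1 : s a = c := by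
      rw [hsx, swap_apply_left, swap_apply_of_ne_of_ne hcb hce, ← hd,
        swap_apply_of_ne_of_ne hdb hde, swap_apply_of_ne_of_ne hda hc, htc]
    have s2 : s c = e := by
      rw [hsx, swap_apply_right, swap_apply_of_ne_of_ne ha.symm hae, ← hb,
        swap_apply_left, swap_apply_of_ne_of_ne hae.symm hce.symm, he]
    have s3 : s e = d := by
      rw [hsx, swap_apply_of_ne_of_ne hae.symm hce.symm, swap_apply_right, hta,
        swap_apply_of_ne_of_ne ha.symm hae, swap_apply_left]
    have s4 : s d = b := by
      rw [hsx, swap_apply_of_ne_of_ne hda hc, swap_apply_of_ne_of_ne hdb hde, htc,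
        swap_apply_of_ne_of_ne hcb hce, swap_apply_right]
    have s5 : s b = a := by
      rw [hsx, swap_apply_of_ne_of_ne ha hcb.symm, swap_apply_left, he,
        swap_apply_right, swap_apply_of_ne_of_ne ha hcb.symm, hta]
    simp only [pow_succ, pow_zero, one_mul, Perm.mul_apply, s1, s2, s3, s4, s5,
      Perm.one_apply] at h7
    exact hca h7

/-- An injective homomorphism that maps transpositions to transpositions is induced on them by an
injection of the underlying set. -/
theorem exists_injective_forall_map_swap [Infinite X] {G : Subgroup (Perm X)}
    (hG : ∀ x y, swap x y ∈ G) (ψ : G →* Perm X) (hψ : Function.Injective ψ)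
    (hswap : ∀ x y, x ≠ y → (ψ ⟨swap x y, hG x y⟩).IsSwap) :
    ∃ f : X → X, Function.Injective f ∧
      ∀ x y, x ≠ y → ψ ⟨swap x y, hG x y⟩ = swap (f x) (f y) := by
  have hcomm : ∀ x y z, x ≠ y → x ≠ z → y ≠ z →
      ¬ Commute (ψ ⟨swap x y, hG x y⟩) (ψ ⟨swap x z, hG x z⟩) := by
    intro x y z hxy hxz hyz h
    have h1 := hψ ((map_mul ψ _ _).trans (h.trans (map_mul ψ _ _).symm))
    have h2 := DFunLike.congr_fun (congrArg Subtype.val h1) x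
    simp only [Subgroup.coe_mul, Perm.mul_apply, swap_apply_left,
      swap_apply_of_ne_of_ne hxz.symm hyz.symm, swap_apply_of_ne_of_ne hxy.symm hyz] at h2
    exact hyz h2.symm
  have hconj : ∀ x y z, x ≠ y → x ≠ z → y ≠ z →
      ψ ⟨swap x y, hG x y⟩ * ψ ⟨swap x z, hG x z⟩ * ψ ⟨swap x y, hG x y⟩ =
        ψ ⟨swap y z, hG y z⟩ := by
    intro x y z hxy hxz hyz
    rw [← map_mul, ← map_mul]
    congr 1
    ext1
    have := swap_apply_apply (swap x y) x z
    rw [swap_apply_left, swap_apply_of_ne_of_ne hxz.symm hyz.symm, swap_inv] at this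
    exact this.symm
  have hcommon : ∀ x, ∃ a, ∀ y, x ≠ y → ψ ⟨swap x y, hG x y⟩ a ≠ a := by
    intro x
    obtain ⟨y, hy⟩ := Infinite.exists_notMem_finset ({x} : Finset X)
    obtain ⟨z, hz⟩ := Infinite.exists_notMem_finset ({x, y} : Finset X)
    simp only [Finset.mem_insert, Finset.mem_singleton, not_or] at hy hz
    obtain ⟨hzx, hzy⟩ := hz
    have hxy := Ne.symm hy
    have hxz := Ne.symm hzx
    have hyz := Ne.symm hzy
    obtain ⟨a, b, c, hb, hc, hbc, h1, h2⟩ :=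
      (hswap x y hxy).exists_common_point (hswap x z hxz) (hcomm x y z hxy hxz hyz)
    -- If the image of `swap x w` fixed `a`, non-commutation would force it to be `swap b c`, which
    -- is already the image of `swap y z`.
    refine ⟨a, fun w hxw hw => ?_⟩
    rcases eq_or_ne w y with rfl | hwy
    · rw [h1, swap_apply_left] at hw
      exact hb hw
    rcases eq_or_ne w z with rfl | hwz
    · rw [h2, swap_apply_left] at hw
      exact hc hw
    have hwb : ψ ⟨swap x w, hG x w⟩ b ≠ b := fun h =>
      hcomm x w y hxw hxy hwy (h1 ▸ commute_swap_of_apply_eq hw h)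
    have hwc : ψ ⟨swap x w, hG x w⟩ c ≠ c := fun h =>
      hcomm x w z hxw hxz hwz (h2 ▸ commute_swap_of_apply_eq hw h)
    have h3 := (hswap x w hxw).eq_swap_of_ne hbc hwb hwc
    have h4 := swap_apply_apply (swap a b) a c
    rw [swap_apply_left, swap_apply_of_ne_of_ne hc hbc.symm, swap_inv, ← h1, ← h2, ← h3,
      hconj x y z hxy hxz hyz] at h4
    have h5 := DFunLike.congr_fun (congrArg Subtype.val (hψ h4)) x
    simp only [swap_apply_left, swap_apply_of_ne_of_ne hxy hxz] at h5
    exact hxw h5.symm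
  choose f hf using hcommon
  have hinj : Function.Injective f := by
    intro x y hfxy
    by_contra hxy
    obtain ⟨z, hz⟩ := Infinite.exists_notMem_finset ({x, y} : Finset X)
    simp only [Finset.mem_insert, Finset.mem_singleton, not_or] at hz
    have hxz := Ne.symm hz.1
    have hyz := Ne.symm hz.2
    have hzx := hf x z hxz
    have hzy := hf y z hyz
    obtain ⟨b, hb, h1⟩ := (hswap x z hxz).exists_eq_swap_of_ne hzx
    obtain ⟨c, hc, h2⟩ := (hswap y z hyz).exists_eq_swap_of_ne hzy
    have h3 := hf x y hxy
    have e1 : (⟨swap x z, hG x z⟩ : G) = ⟨swap z x, hG z x⟩ := Subtype.ext (swap_comm _ _)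
    have e2 : (⟨swap y z, hG y z⟩ : G) = ⟨swap z y, hG z y⟩ := Subtype.ext (swap_comm _ _)
    rw [← hfxy] at hc h2
    rw [← hconj z x y hxz.symm hyz.symm hxy, ← e1, ← e2, h1, h2] at h3
    apply h3
    -- If `f x = f y`, the image of `swap x y` is a conjugate of `swap (f x) c` by `swap (f x) b`,
    -- which fixes `f x` once `b ≠ c`.
    have hbc : b ≠ c := by
      rintro rfl
      have := DFunLike.congr_fun (congrArg Subtype.val (hψ (h1.trans h2.symm))) x
      simp only [swap_apply_left, swap_apply_of_ne_of_ne hxy hxz] at this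
      exact hz.1 this
    simp only [Perm.mul_apply, swap_apply_left, swap_apply_of_ne_of_ne hb hbc, swap_apply_right]
  refine ⟨f, hinj, fun x y hxy => ?_⟩
  refine (hswap x y hxy).eq_swap_of_ne (hinj.ne hxy) (hf x y hxy) ?_
  have e1 : (⟨swap x y, hG x y⟩ : G) = ⟨swap y x, hG y x⟩ := Subtype.ext (swap_comm _ _)
  rw [e1]
  exact hf y x hxy.symm

/-- If a group of permutations of an infinite set contains all transpositions and each of its
involutions has a fixed point, then its automorphisms are conjugations by permutations. -/
theorem exists_perm_forall_mulEquiv_apply [Infinite X] {G : Subgroup (Perm X)}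
    (hG : ∀ x y, swap x y ∈ G) (hfix : ∀ t ∈ G, t * t = 1 → ∃ x, t x = x) (φ : G ≃* G) :
    ∃ f : Perm X, ∀ g : G, (φ g : Perm X) = f * g * f⁻¹ := by
  have hpres : ∀ (φ : G ≃* G) (x y : X), x ≠ y → (φ ⟨swap x y, hG x y⟩ : Perm X).IsSwap := by
    intro φ x y hxy
    have h := (isSwap_iff_of_forall_involution hG hfix (hG x y)).mp ⟨x, y, hxy, rfl⟩
    rw [isSwap_iff_of_forall_involution hG hfix (φ _).2]
    refine ⟨fun h1 => h.1 ?_, ?_, fun g hg => ?_⟩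
    · have : φ ⟨swap x y, hG x y⟩ = 1 := Subtype.ext h1
      rw [map_eq_one_iff φ φ.injective] at this
      exact congrArg Subtype.val this
    · rw [← Subgroup.coe_mul, ← map_mul]
      have : (⟨swap x y, hG x y⟩ * ⟨swap x y, hG x y⟩ : G) = 1 := Subtype.ext h.2.1
      rw [this, map_one, Subgroup.coe_one]
    · have h6 := h.2.2 (φ.symm ⟨g, hg⟩) (φ.symm ⟨g, hg⟩).2
      have : ((⟨swap x y, hG x y⟩ : G) *
          (φ.symm ⟨g, hg⟩ * ⟨swap x y, hG x y⟩ * (φ.symm ⟨g, hg⟩)⁻¹)) ^ 6 = 1 := Subtype.ext h6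
      have := congrArg φ this
      simp only [map_pow, map_mul, map_inv, MulEquiv.apply_symm_apply, map_one] at this
      exact congrArg Subtype.val this
  have hmap : ∀ φ : G ≃* G, ∃ f : X → X, Function.Injective f ∧
      ∀ x y, x ≠ y → φ ⟨swap x y, hG x y⟩ = ⟨swap (f x) (f y), hG _ _⟩ := by
    intro φ
    obtain ⟨f, hf, h⟩ := exists_injective_forall_map_swap hG (G.subtype.comp φ.toMonoidHom)
      (Subtype.val_injective.comp φ.injective) (hpres φ)
    exact ⟨f, hf, fun x y hxy => Subtype.ext (h x y hxy)⟩
  have hpts : ∀ x : X, ∃ y z, x ≠ y ∧ y ≠ z ∧ x ≠ z := by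
    intro x
    obtain ⟨y, hy⟩ := Infinite.exists_notMem_finset ({x} : Finset X)
    obtain ⟨z, hz⟩ := Infinite.exists_notMem_finset ({x, y} : Finset X)
    simp only [Finset.mem_insert, Finset.mem_singleton, not_or] at hy hz
    exact ⟨y, z, Ne.symm hy, Ne.symm hz.2, Ne.symm hz.1⟩
  have hinv : ∀ (φ : G ≃* G) (f f' : X → X), Function.Injective f → Function.Injective f' →
      (∀ x y, x ≠ y → φ ⟨swap x y, hG x y⟩ = ⟨swap (f x) (f y), hG _ _⟩) →
      (∀ x y, x ≠ y → φ.symm ⟨swap x y, hG x y⟩ = ⟨swap (f' x) (f' y), hG _ _⟩) →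
      ∀ x, f' (f x) = x := by
    intro φ f f' hf hf' h h' x
    have key : ∀ y, x ≠ y → swap x y = swap (f' (f x)) (f' (f y)) := by
      intro y hxy
      have := congrArg φ.symm (h x y hxy)
      rw [h' _ _ (hf.ne hxy), MulEquiv.symm_apply_apply] at this
      exact congrArg Subtype.val this
    obtain ⟨y, z, hxy, hyz, hxz⟩ := hpts x
    exact (eq_of_swap_eq_swap hxy hyz hxz (key y hxy) (key z hxz)).symm
  obtain ⟨f, hf, h⟩ := hmap φ
  obtain ⟨f', hf', h'⟩ := hmap φ.symm
  refine ⟨⟨f, f', hinv φ f f' hf hf' h h', hinv φ.symm f' f hf' hf h' h⟩, fun g => ?_⟩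
  rw [eq_mul_inv_iff_mul_eq]
  ext1 x
  -- Both sides are the image under `φ` of `g * swap x y * g⁻¹`; two choices of `y` then determine
  -- the image of `x`.
  have key : ∀ y, x ≠ y → swap ((φ g : Perm X) (f x)) ((φ g : Perm X) (f y)) =
      swap (f ((g : Perm X) x)) (f ((g : Perm X) y)) := by
    intro y hxy
    have h1 : g * ⟨swap x y, hG x y⟩ * g⁻¹ = (⟨swap _ _, hG ((g : Perm X) x) ((g : Perm X) y)⟩ : G) :=
      Subtype.ext (swap_apply_apply (g : Perm X) x y).symm
    have h2 := congrArg φ h1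
    rw [map_mul, map_mul, map_inv, h x y hxy, h _ _ ((g : Perm X).injective.ne hxy)] at h2
    rw [swap_apply_apply (φ g : Perm X)]
    exact congrArg Subtype.val h2
  obtain ⟨y, z, hxy, hyz, hxz⟩ := hpts x
  have hi := (φ g : Perm X).injective.comp hf
  exact eq_of_swap_eq_swap (hi.ne hxy) (hi.ne hyz) (hi.ne hxz) (key y hxy) (key z hxz)

end Swaps

/-! ### Eventual translations of the integer line -/

section Line

open Equiv Filter

/-- The two rays glued to a line. -/
def lineEquiv : Fin 2 × ℕ ≃ ℤ where
  toFun
    | (0, p) => Int.negSucc p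
    | (1, p) => Int.ofNat p
  invFun
    | Int.ofNat p => (1, p)
    | Int.negSucc p => (0, p)
  left_inv := by
    rintro ⟨i, p⟩
    fin_cases i <;> rfl
  right_inv := by
    rintro (p | p) <;> rfl

theorem lineEquiv_zero (p : ℕ) : lineEquiv (0, p) = -(p : ℤ) - 1 := by
  change Int.negSucc p = _
  omega

theorem lineEquiv_one (p : ℕ) : lineEquiv (1, p) = p := rfl

/-- A self-map of the line that is a translation near `+∞` and a translation near `-∞`. -/
def IsTranslationNearEnds (h : ℤ → ℤ) : Prop :=
  ∃ m m' : ℤ, (∀ᶠ x in atTop, h x = x + m) ∧ ∀ᶠ x in atBot, h x = x + m'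

theorem mem_houghton_two_iff {g : Perm (Fin 2 × ℕ)} :
    g ∈ Houghton 2 ↔ IsTranslationNearEnds (lineEquiv.permCongr g) := by
  constructor
  · rintro ⟨m, K, hK, h⟩
    have h1 : ∀ᶠ x in (cofinite : Filter ℤ), lineEquiv.symm x ∉ K := by
      rw [eventually_cofinite]
      simp only [not_not]
      exact hK.preimage lineEquiv.symm.injective.injOn
    rw [Int.cofinite_eq, eventually_sup] at h1
    refine ⟨m 1, -m 0, ?_, ?_⟩
    · filter_upwards [h1.2, eventually_ge_atTop 0] with x hx hx0
      obtain ⟨⟨i, p⟩, rfl⟩ := lineEquiv.surjective x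
      rw [symm_apply_apply] at hx
      rw [permCongr_apply, symm_apply_apply]
      obtain ⟨h2, h3⟩ := h _ hx
      rcases hg : g (i, p) with ⟨j, q⟩
      rw [hg] at h2 h3
      simp only at h2 h3
      subst h2
      fin_cases j
      · simp only [Fin.zero_eta, lineEquiv_zero] at hx0
        omega
      · simpa only [Fin.mk_one, lineEquiv_one] using h3
    · filter_upwards [h1.1, eventually_lt_atBot 0] with x hx hx0
      obtain ⟨⟨i, p⟩, rfl⟩ := lineEquiv.surjective x
      rw [symm_apply_apply] at hx
      rw [permCongr_apply, symm_apply_apply]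
      obtain ⟨h2, h3⟩ := h _ hx
      rcases hg : g (i, p) with ⟨j, q⟩
      rw [hg] at h2 h3
      simp only at h2 h3
      subst h2
      fin_cases j
      · simp only [Fin.zero_eta, lineEquiv_zero] at h3 ⊢
        omega
      · simp only [Fin.mk_one, lineEquiv_one] at hx0
        omega
  · rintro ⟨m, m', h1, h2⟩
    -- Points carried across the origin change ray, so they too must go into the finite exceptional
    -- set.
    have h3 : ∀ᶠ x in (cofinite : Filter ℤ),
        (0 ≤ x → 0 ≤ x + m ∧ lineEquiv.permCongr g x = x + m) ∧
          (x < 0 → x + m' < 0 ∧ lineEquiv.permCongr g x = x + m') := by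
      rw [Int.cofinite_eq, eventually_sup]
      constructor
      · filter_upwards [h2, eventually_lt_atBot 0, eventually_lt_atBot (-m')] with x a b c
        exact ⟨fun h => by omega, fun _ => ⟨by omega, a⟩⟩
      · filter_upwards [h1, eventually_ge_atTop 0, eventually_ge_atTop (-m)] with x a b c
        exact ⟨fun _ => ⟨by omega, a⟩, fun h => by omega⟩
    refine ⟨![-m', m], _, (eventually_cofinite.mp h3).preimage lineEquiv.injective.injOn, ?_⟩
    rintro ⟨i, p⟩ hx
    rw [Set.mem_preimage, Set.mem_ofPred_eq, not_not, permCongr_apply, symm_apply_apply] at hx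
    rcases hg : g (i, p) with ⟨j, q⟩
    rw [hg] at hx
    fin_cases i <;> fin_cases j <;>
      simp only [Fin.zero_eta, Fin.mk_one, lineEquiv_one, lineEquiv_zero] at hx
    · exact ⟨rfl, by simp only [Fin.zero_eta, Matrix.cons_val_zero]; omega⟩
    · omega
    · omega
    · exact ⟨rfl, by simp only [Fin.mk_one, Matrix.cons_val_one, Matrix.cons_val_fin_one]; omega⟩

/-- Injections pull cofinite sets back to cofinite sets, and cofinite on `ℤ` means near both ends.
Both hypotheses are needed because `f x` may approach either end. -/
theorem eventually_comp_of_injective {f : ℤ → ℤ} (hf : Function.Injective f) {p : ℤ → Prop}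
    (h1 : ∀ᶠ x in atTop, p x) (h2 : ∀ᶠ x in atBot, p x) : ∀ᶠ x in atTop, p (f x) := by
  have h : ∀ᶠ x in cofinite, p x := by
    rw [Int.cofinite_eq, eventually_sup]
    exact ⟨h2, h1⟩
  have h' := hf.tendsto_cofinite.eventually h
  rw [Int.cofinite_eq, eventually_sup] at h'
  exact h'.2

/-- An injection that intertwines the unit translation with a translation near the ends is affine
near `+∞`. -/
theorem IsTranslationNearEnds.eventually_affine {f h : ℤ → ℤ} (hh : IsTranslationNearEnds h)
    (hf : Function.Injective f) (hfh : ∀ x, f (x + 1) = h (f x)) :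
    ∃ a c : ℤ, ∀ᶠ x in atTop, f x = a * x + c := by
  obtain ⟨m, m', h1, h2⟩ := hh
  obtain ⟨N, hN⟩ := eventually_atTop.mp h1
  obtain ⟨N', hN'⟩ := eventually_atBot.mp h2
  -- Beyond `±M` a single application of `h` cannot jump from one end to the other, so the orbit
  -- stays at one end.
  set M := |N| + |N'| + |m| + |m'| with hM
  have l1 := le_abs_self N
  have l2 := neg_abs_le N'
  have l3 := neg_abs_le m
  have l4 := le_abs_self m'
  have p1 := abs_nonneg N
  have p2 := abs_nonneg N'
  have p3 := abs_nonneg m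
  have p4 := abs_nonneg m'
  have h3 : ∀ᶠ x in atTop, M < f x ∨ f x < -M :=
    eventually_comp_of_injective hf ((eventually_gt_atTop M).mono fun _ => Or.inl)
      ((eventually_lt_atBot (-M)).mono fun _ => Or.inr)
  obtain ⟨X, hX⟩ := eventually_atTop.mp h3
  rcases hX X le_rfl with h4 | h4
  · refine ⟨m, f X - m * X, eventually_atTop.mpr ⟨X, fun x hx => ?_⟩⟩
    have : M < f x ∧ f x = m * x + (f X - m * X) := by
      induction x, hx using Int.leInduction with
      | base => exact ⟨h4, by ring⟩
      | succ x hx ih =>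
        have e : f (x + 1) = f x + m := by rw [hfh, hN _ (by omega)]
        refine ⟨?_, by rw [e, ih.2]; ring⟩
        rcases hX (x + 1) (by omega) with h5 | h5 <;> omega
    exact this.2
  · refine ⟨m', f X - m' * X, eventually_atTop.mpr ⟨X, fun x hx => ?_⟩⟩
    have : f x < -M ∧ f x = m' * x + (f X - m' * X) := by
      induction x, hx using Int.leInduction with
      | base => exact ⟨h4, by ring⟩
      | succ x hx ih =>
        have e : f (x + 1) = f x + m' := by rw [hfh, hN' _ (by omega)]
        refine ⟨?_, by rw [e, ih.2]; ring⟩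
        rcases hX (x + 1) (by omega) with h5 | h5 <;> omega
    exact this.2

theorem eventually_atTop_neg {p : ℤ → Prop} (h : ∀ᶠ x in atTop, p (-x)) : ∀ᶠ x in atBot, p x := by
  simpa using tendsto_neg_atBot_atTop.eventually h

/-- At one large `x`, `f' (f x) = x` reads `x = b * a * x + k` with `|k| < x`. Then `x` divides `k`,
so `k = 0` and `a` is a unit of `ℤ`. -/
theorem slope_eq_one_or_neg_one {f f' : ℤ → ℤ} (hf : Function.LeftInverse f' f) {a c : ℤ}
    (h : ∀ᶠ x in atTop, f x = a * x + c) {a₁ c₁ a₂ c₂ : ℤ}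
    (h1 : ∀ᶠ x in atTop, f' x = a₁ * x + c₁) (h2 : ∀ᶠ x in atBot, f' x = a₂ * x + c₂) :
    a = 1 ∨ a = -1 := by
  have h3 : ∀ᶠ x in atTop, f' (f x) = a₁ * f x + c₁ ∨ f' (f x) = a₂ * f x + c₂ :=
    eventually_comp_of_injective hf.injective (p := fun x => f' x = a₁ * x + c₁ ∨ f' x = a₂ * x + c₂)
      (h1.mono fun _ => Or.inl) (h2.mono fun _ => Or.inr)
  obtain ⟨x, hx, hx', hx1, hx2⟩ := (h.and (h3.and ((eventually_gt_atTop |a₁ * c + c₁|).and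
    (eventually_gt_atTop |a₂ * c + c₂|)))).exists
  have key : ∀ b k : ℤ, |k| < x → x = b * a * x + k → a = 1 ∨ a = -1 := by
    intro b k hk e
    have hk0 : k = 0 := Int.eq_zero_of_abs_lt_dvd ⟨1 - b * a, by linear_combination -e⟩ hk
    have hx0 : x ≠ 0 := by
      rintro rfl
      exact absurd hk (not_lt.mpr (abs_nonneg k))
    have : b * a = 1 := by
      apply mul_right_cancel₀ hx0
      linear_combination -hk0 - e
    exact Int.isUnit_iff.mp (IsUnit.of_mul_eq_one b (by rw [mul_comm]; exact this))
  rw [hf x, hx] at hx'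
  rcases hx' with e | e
  · exact key a₁ _ hx1 (by linear_combination e)
  · exact key a₂ _ hx2 (by linear_combination e)

/-- A permutation of the line that conjugates the unit translation, in both directions, to
translations near the ends is a translation near the ends after squaring. -/
theorem isTranslationNearEnds_sq {F : Perm ℤ}
    (h1 : IsTranslationNearEnds (F * Equiv.addRight 1 * F⁻¹ : Perm ℤ))
    (h2 : IsTranslationNearEnds (F * (Equiv.addRight 1)⁻¹ * F⁻¹ : Perm ℤ))
    (h3 : IsTranslationNearEnds (F⁻¹ * Equiv.addRight 1 * F : Perm ℤ))
    (h4 : IsTranslationNearEnds (F⁻¹ * (Equiv.addRight 1)⁻¹ * F : Perm ℤ)) :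
    IsTranslationNearEnds (F * F : Perm ℤ) := by
  have ends : ∀ F : Perm ℤ, IsTranslationNearEnds (F * Equiv.addRight 1 * F⁻¹ : Perm ℤ) →
      IsTranslationNearEnds (F * (Equiv.addRight 1)⁻¹ * F⁻¹ : Perm ℤ) →
      ∃ a c b d : ℤ, (∀ᶠ x in atTop, F x = a * x + c) ∧ ∀ᶠ x in atBot, F x = b * x + d := by
    intro F h1 h2
    obtain ⟨a, c, h⟩ := h1.eventually_affine F.injective (fun x => by simp [Perm.mul_apply])
    obtain ⟨b, d, h'⟩ := h2.eventually_affine (f := fun x => F (-x))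
      (F.injective.comp neg_injective) (fun x => by
        simp [Perm.mul_apply, Equiv.addRight, add_comm])
    refine ⟨a, c, -b, d, h, eventually_atTop_neg ?_⟩
    filter_upwards [h'] with x hx
    rw [hx]
    ring
  obtain ⟨a, c, b, d, hT, hB⟩ := ends F h1 h2
  obtain ⟨a', c', b', d', hT', hB'⟩ := ends F⁻¹ (by simpa using h3) (by simpa using h4)
  have hl : Function.LeftInverse (F⁻¹ : Perm ℤ) F := F.symm_apply_apply
  have ha := slope_eq_one_or_neg_one hl hT hT' hB'
  have hb : -b = 1 ∨ -b = -1 := by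
    refine slope_eq_one_or_neg_one (f := fun x => F (-x)) (f' := fun x => -F⁻¹ x) (c := d)
      (a₁ := -a') (c₁ := -c') (a₂ := -b') (c₂ := -d') ?_ ?_ ?_ ?_
    · intro x
      simp
    · filter_upwards [tendsto_neg_atTop_atBot.eventually hB] with x hx
      rw [hx]
      ring
    · filter_upwards [hT'] with x hx
      rw [hx]
      ring
    · filter_upwards [hB'] with x hx
      rw [hx]
      ring
  obtain ⟨X, hX⟩ := eventually_atTop.mp hT
  obtain ⟨Y, hY⟩ := eventually_atBot.mp hB
  rcases ha with rfl | rfl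
  · obtain rfl | rfl : b = 1 ∨ b = -1 := by omega
    · refine ⟨c + c, d + d, ?_, ?_⟩
      · filter_upwards [eventually_ge_atTop X, eventually_ge_atTop (X - c)] with x h1 h2
        rw [Perm.mul_apply, hX x h1, hX _ (by omega)]
        ring
      · filter_upwards [eventually_le_atBot Y, eventually_le_atBot (Y - d)] with x h1 h2
        rw [Perm.mul_apply, hY x h1, hY _ (by omega)]
        ring
    -- Both ends would go to `+∞`: `x` and `d - c - x` have the same image for large `x`.
    · exfalso
      have e1 := hX (|X| + |Y| + |c| + |d| + 1) (by grind)
      have e2 := hY (d - c - (|X| + |Y| + |c| + |d| + 1)) (by grind)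
      have := F.injective (e1.trans (Eq.trans (by ring) e2.symm))
      grind
  · obtain rfl | rfl : b = 1 ∨ b = -1 := by omega
    · exfalso
      have e1 := hX (|X| + |Y| + |c| + |d| + 1) (by grind)
      have e2 := hY (c - d - (|X| + |Y| + |c| + |d| + 1)) (by grind)
      have := F.injective (e1.trans (Eq.trans (by ring) e2.symm))
      grind
    -- Here `F` exchanges the ends; this is the case that requires squaring.
    · refine ⟨d - c, c - d, ?_, ?_⟩
      · filter_upwards [eventually_ge_atTop X, eventually_ge_atTop (c - Y)] with x h1 h2
        rw [Perm.mul_apply, hX x h1, hY _ (by omega)]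
        ring
      · filter_upwards [eventually_le_atBot Y, eventually_le_atBot (d - X)] with x h1 h2
        rw [Perm.mul_apply, hY x h1, hX _ (by omega)]
        ring

end Line

/-! ### Word length and growth rate -/

section Growth

open Filter Topology

variable {G : Type*} [Group G] {A : Set G}

theorem exists_list_of_closure_eq_top (hA : Subgroup.closure A = ⊤) (g : G) :
    ∃ w : List G, (∀ x ∈ w, x ∈ A ∨ x⁻¹ ∈ A) ∧ w.prod = g := by
  have hg : g ∈ (Subgroup.closure A).toSubmonoid := by rw [hA]; trivial
  rw [Subgroup.closure_toSubmonoid] at hg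
  exact Submonoid.exists_list_of_mem_closure hg

theorem exists_list_length_eq_wordLength (hA : Subgroup.closure A = ⊤) (g : G) :
    ∃ w : List G, (∀ x ∈ w, x ∈ A ∨ x⁻¹ ∈ A) ∧ w.prod = g ∧ w.length = wordLength A g := by
  obtain ⟨w, hw, hg⟩ := exists_list_of_closure_eq_top hA g
  have hne : {k : ℕ | ∃ w : List G, (∀ x ∈ w, x ∈ A ∨ x⁻¹ ∈ A) ∧ w.prod = g ∧
      w.length = k}.Nonempty := ⟨w.length, w, hw, hg, rfl⟩
  exact Nat.sInf_mem hne

theorem wordLength_mul_le (hA : Subgroup.closure A = ⊤) (g h : G) :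
    wordLength A (g * h) ≤ wordLength A g + wordLength A h := by
  obtain ⟨v, hv, rfl, hvl⟩ := exists_list_length_eq_wordLength hA g
  obtain ⟨w, hw, rfl, hwl⟩ := exists_list_length_eq_wordLength hA h
  refine Nat.sInf_le ⟨v ++ w, fun x hx => ?_, List.prod_append, by rw [List.length_append, hvl, hwl]⟩
  rcases List.mem_append.mp hx with hx | hx
  exacts [hv x hx, hw x hx]

theorem one_le_wordLength (hA : Subgroup.closure A = ⊤) {g : G} (hg : g ≠ 1) :
    1 ≤ wordLength A g := by
  obtain ⟨w, -, hwg, hl⟩ := exists_list_length_eq_wordLength hA g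
  by_contra! h
  rw [Nat.lt_one_iff.mp h, List.length_eq_zero_iff] at hl
  exact hg (by rw [← hwg, hl, List.prod_nil])

theorem tendsto_linear_rpow_one_div (C : ℕ) (hC : 0 < C) :
    Tendsto (fun k : ℕ => ((C * (k + 1) : ℕ) : ℝ≥0∞) ^ (1 / (k : ℝ))) atTop (𝓝 1) := by
  -- Substituting `x = C * (k + 1)` turns the exponent `C / (x - C)` into `1 / k`, even at `k = 0`,
  -- where both are `0`.
  have h1 := (tendsto_rpow_div_mul_add C 1 (-C) zero_ne_one).comp
    (g := fun x : ℝ => x ^ ((C : ℝ) / (1 * x + -C))) (f := fun k : ℕ => ((C * (k + 1) : ℕ) : ℝ))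
    (tendsto_natCast_atTop_atTop.comp
      (tendsto_atTop_mono (fun k => k.le_succ.trans (Nat.le_mul_of_pos_left _ hC)) tendsto_id))
  have h2 := ENNReal.tendsto_ofReal h1
  rw [ENNReal.ofReal_one] at h2
  refine h2.congr fun k => ?_
  have hC' : (C : ℝ) ≠ 0 := by positivity
  have e : (C : ℝ) / (1 * ((C * (k + 1) : ℕ) : ℝ) + -C) = 1 / k := by
    rw [show 1 * ((C * (k + 1) : ℕ) : ℝ) + -(C : ℝ) = C * k by push_cast; ring, ← div_div,
      div_self hC']
  simp only [Function.comp]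
  rw [e, ← ENNReal.ofReal_rpow_of_nonneg (by positivity) (by positivity), ENNReal.ofReal_natCast]

/-- An injective endomorphism of a nontrivial group with a linear bound on the word lengths of all
its orbits has growth rate `1`. -/
theorem growthRate_eq_one_of_linear_bound [Nontrivial G] (hA : Subgroup.closure A = ⊤) (φ : G →* G)
    (hφ : Function.Injective φ)
    (h : ∀ g, ∃ C, ∀ k : ℕ, wordLength A (φ^[k] g) ≤ C * (k + 1)) : growthRate A φ = 1 := by
  refine le_antisymm (iSup_le fun g => ?_) ?_
  · obtain ⟨C, hC⟩ := h g
    rw [← (tendsto_linear_rpow_one_div (C + 1) C.succ_pos).limsup_eq]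
    refine limsup_le_limsup (Eventually.of_forall fun k => ?_)
    refine ENNReal.rpow_le_rpow (Nat.cast_le.mpr ((hC k).trans ?_)) (by positivity)
    exact Nat.mul_le_mul_right _ C.le_succ
  · obtain ⟨g, hg⟩ := exists_ne (1 : G)
    refine le_iSup_of_le g ?_
    rw [← limsup_const (f := (atTop : Filter ℕ)) (1 : ℝ≥0∞)]
    refine limsup_le_limsup (Eventually.of_forall fun k => ?_)
    have hk : φ^[k] g ≠ 1 := fun hk =>
      hg (hφ.iterate k (hk.trans (iterate_map_one φ k).symm))
    have h1 : (1 : ℝ≥0∞) ≤ (wordLength A (φ^[k] g) : ℝ≥0∞) :=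
      Nat.one_le_cast.mpr (one_le_wordLength hA hk)
    calc (1 : ℝ≥0∞) = 1 ^ (1 / (k : ℝ)) := (ENNReal.one_rpow _).symm
      _ ≤ _ := ENNReal.rpow_le_rpow h1 (by positivity)

/-- If the square of an endomorphism is an inner automorphism, then its orbits have linearly
bounded word lengths. -/
theorem exists_linear_bound_of_sq_inner (hA : Subgroup.closure A = ⊤) (φ : G →* G) (u : G)
    (hu : ∀ g, φ (φ g) = u * g * u⁻¹) (g : G) :
    ∃ C, ∀ k : ℕ, wordLength A (φ^[k] g) ≤ C * (k + 1) := by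
  -- The last two terms cover the starting cases `k = 0, 1`; the first two pay for each double step.
  refine ⟨wordLength A u + wordLength A u⁻¹ + wordLength A g + wordLength A (φ g), fun k => ?_⟩
  induction k using Nat.twoStepInduction with
  | zero => simp only [Function.iterate_zero, id]; omega
  | one => simp only [Function.iterate_one]; omega
  | more k ih _ =>
    rw [Function.iterate_succ_apply', Function.iterate_succ_apply', hu]
    have h1 := wordLength_mul_le hA (u * φ^[k] g) u⁻¹
    have h2 := wordLength_mul_le hA u (φ^[k] g)
    nlinarith

end Growth

/-! ### Generation by the translation and one transposition -/

section Generation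

open Equiv Filter

/-- Values beyond the shifted window are already taken by points outside the window `(-M, M)`, so
`F` injects the window into the shifted one; compare cardinalities. -/
theorem shift_le_shift {F : Perm ℤ} {m m' : ℤ} (h : ∀ᶠ x in atTop, F x = x + m)
    (h' : ∀ᶠ x in atBot, F x = x + m') : m' ≤ m := by
  obtain ⟨N, hN⟩ := eventually_atTop.mp h
  obtain ⟨N', hN'⟩ := eventually_atBot.mp h'
  set M := |N| + |N'| + 1 + |m| + |m'| with hM
  have hmaps : Set.MapsTo F (Finset.Ioo (-M) M : Finset ℤ) (Finset.Ioo (-M + m') (M + m) : Finset ℤ) := by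
    intro x hx
    rw [Finset.mem_coe, Finset.mem_Ioo] at hx ⊢
    constructor
    · by_contra! hc
      have := F.injective ((hN' (F x - m') (by grind)).trans (sub_add_cancel _ _))
      omega
    · by_contra! hc
      have := F.injective ((hN (F x - m) (by grind)).trans (sub_add_cancel _ _))
      omega
  have := Finset.card_le_card_of_injOn F hmaps F.injective.injOn
  rw [Int.card_Ioo, Int.card_Ioo] at this
  grind

theorem shift_eq_shift {F : Perm ℤ} {m m' : ℤ} (h : ∀ᶠ x in atTop, F x = x + m)
    (h' : ∀ᶠ x in atBot, F x = x + m') : m = m' := by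
  refine le_antisymm ?_ (shift_le_shift h h')
  have h1 : ∀ᶠ x in atTop, F⁻¹ x = x + -m := by
    filter_upwards [(tendsto_atTop_add_const_right _ (-m) tendsto_id).eventually h] with x hx
    rw [Perm.inv_eq_iff_eq]
    simpa using hx.symm
  have h2 : ∀ᶠ x in atBot, F⁻¹ x = x + -m' := by
    filter_upwards [(tendsto_atBot_add_const_right _ (-m') tendsto_id).eventually h'] with x hx
    rw [Perm.inv_eq_iff_eq]
    simpa using hx.symm
  have := shift_le_shift h1 h2
  omega

theorem permCongrHom_translationPerm :
    lineEquiv.permCongrHom translationPerm = Equiv.addRight (1 : ℤ) := by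
  ext x
  obtain ⟨⟨i, p⟩, rfl⟩ := lineEquiv.surjective x
  rw [permCongrHom_coe, permCongr_apply, symm_apply_apply]
  fin_cases i
  · cases p with
    | zero => rfl
    | succ p =>
      change lineEquiv (0, p) = lineEquiv (0, p + 1) + 1
      rw [lineEquiv_zero, lineEquiv_zero]
      push_cast
      ring
  · rfl

theorem translationPerm_apply_symm (n : ℤ) :
    translationPerm (lineEquiv.symm n) = lineEquiv.symm (n + 1) := by
  rw [eq_symm_apply]
  exact DFunLike.congr_fun permCongrHom_translationPerm n

theorem translationPerm_zpow_apply (k n : ℤ) :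
    (translationPerm ^ k) (lineEquiv.symm n) = lineEquiv.symm (n + k) := by
  induction k generalizing n with
  | zero => rw [zpow_zero, Perm.one_apply, add_zero]
  | succ k ih =>
    rw [zpow_add_one, Perm.mul_apply, translationPerm_apply_symm, ih]
    congr 1
    ring
  | pred k ih =>
    have h : translationPerm⁻¹ (lineEquiv.symm n) = lineEquiv.symm (n - 1) := by
      rw [Perm.inv_eq_iff_eq, translationPerm_apply_symm, sub_add_cancel]
    rw [zpow_sub_one, Perm.mul_apply, h, ih]
    congr 1
    ring

theorem swap_mem_of_translationPerm_mem {C : Subgroup (Perm (Fin 2 × ℕ))}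
    (h1 : translationPerm ∈ C) (h2 : swap (0, 0) (0, 1) ∈ C) (x y : Fin 2 × ℕ) : swap x y ∈ C := by
  have adj : ∀ n : ℤ, swap (lineEquiv.symm n) (lineEquiv.symm (n + 1)) ∈ C := by
    intro n
    -- On the line, `(0, 0)` and `(0, 1)` are `-1` and `-2`, hence the exponent `n + 2`.
    have h := swap_apply_apply (translationPerm ^ (n + 2)) (lineEquiv.symm (-2)) (lineEquiv.symm (-1))
    rw [translationPerm_zpow_apply, translationPerm_zpow_apply, show -2 + (n + 2) = n by ring,
      show -1 + (n + 2) = n + 1 by ring] at h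
    rw [h]
    refine C.mul_mem (C.mul_mem (C.zpow_mem h1 _) ?_) (C.inv_mem (C.zpow_mem h1 _))
    rw [swap_comm]
    exact h2
  have up : ∀ (n : ℤ) (k : ℕ), swap (lineEquiv.symm n) (lineEquiv.symm (n + k)) ∈ C := by
    intro n k
    induction k with
    | zero => rw [Nat.cast_zero, add_zero, swap_self]; exact C.one_mem
    | succ k ih =>
      have := SubmonoidClass.swap_mem_trans C ih (adj (n + k))
      rwa [add_assoc] at this
  have all : ∀ a b : ℤ, a ≤ b → swap (lineEquiv.symm a) (lineEquiv.symm b) ∈ C := by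
    intro a b hab
    have := up a (b - a).toNat
    rwa [Int.toNat_of_nonneg (by omega), add_sub_cancel] at this
  rw [← lineEquiv.symm_apply_apply x, ← lineEquiv.symm_apply_apply y]
  rcases le_total (lineEquiv x) (lineEquiv y) with h | h
  · exact all _ _ h
  · rw [swap_comm]
    exact all _ _ h

theorem mem_of_finite_support {X : Type*} [DecidableEq X] {C : Subgroup (Perm X)}
    (hC : ∀ x y, swap x y ∈ C) {g : Perm X} (hg : {x | g x ≠ x}.Finite) : g ∈ C := by
  have h : g ∈ Subgroup.closure {σ : Perm X | σ.IsSwap} := _root_.mem_closure_isSwap'.mpr hg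
  refine (Subgroup.closure_le C).mpr ?_ h
  rintro _ ⟨x, y, -, rfl⟩
  exact hC x y

theorem houghton_two_le {C : Subgroup (Perm (Fin 2 × ℕ))}
    (h1 : translationPerm ∈ C) (h2 : swap (0, 0) (0, 1) ∈ C) : Houghton 2 ≤ C := by
  intro g hg
  obtain ⟨m, m', hT, hB⟩ := mem_houghton_two_iff.mp hg
  obtain rfl := shift_eq_shift hT hB
  have h3 : ∀ᶠ x in cofinite, lineEquiv.permCongr g x = x + m := by
    rw [Int.cofinite_eq, eventually_sup]
    exact ⟨hB, hT⟩
  rw [← C.mul_mem_cancel_left (C.zpow_mem h1 (-m))]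
  refine mem_of_finite_support (swap_mem_of_translationPerm_mem h1 h2)
    (((eventually_cofinite.mp h3).preimage lineEquiv.injective.injOn).subset fun x hx hx' => hx ?_)
  rw [permCongr_apply, symm_apply_apply] at hx'
  rw [Perm.mul_apply, ← lineEquiv.symm_apply_apply (g x), hx', translationPerm_zpow_apply,
    add_neg_cancel_right, symm_apply_apply]

theorem closure_houghtonG2_houghtonAlpha :
    Subgroup.closure ({houghtonG2, houghtonAlpha} : Set (Houghton 2)) = ⊤ := by
  have h : Houghton 2 ≤ (Subgroup.closure
      ({houghtonG2, houghtonAlpha} : Set (Houghton 2))).map (Houghton 2).subtype := by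
    refine houghton_two_le ?_ ?_
    · exact Subgroup.mem_map_of_mem (Houghton 2).subtype
        (Subgroup.subset_closure (Set.mem_insert houghtonG2 {houghtonAlpha}))
    · exact Subgroup.mem_map_of_mem (Houghton 2).subtype
        (Subgroup.subset_closure (Set.mem_insert_of_mem houghtonG2 (Set.mem_singleton houghtonAlpha)))
  rw [eq_top_iff]
  intro g _
  obtain ⟨g', hg', e⟩ := Subgroup.mem_map.mp (h g.2)
  rwa [← Subtype.ext e]

end Generation

/-! ### Automorphisms of the two-ray group -/

section Automorphisms

open Equiv Filter

theorem swap_mem_houghton_two (x y : Fin 2 × ℕ) : swap x y ∈ Houghton 2 :=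
  swap_mem_of_translationPerm_mem houghtonG2.2 houghtonAlpha.2 x y

/-- Far out `t` is a shift by `m`, so `t * t` shifts by `2 * m`; this forces `m = 0` and far points
are fixed. -/
theorem exists_fixed_point_of_involution {t : Perm (Fin 2 × ℕ)} (ht : t ∈ Houghton 2)
    (h : t * t = 1) : ∃ x, t x = x := by
  obtain ⟨m, -, hT, -⟩ := mem_houghton_two_iff.mp ht
  obtain ⟨x, hx, hx'⟩ :=
    (hT.and ((tendsto_atTop_add_const_right _ m tendsto_id).eventually hT)).exists
  have h1 : lineEquiv.permCongr t (lineEquiv.permCongr t x) = x := by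
    have : t (t (lineEquiv.symm x)) = lineEquiv.symm x := by rw [← Perm.mul_apply, h, Perm.one_apply]
    simp [permCongr_apply, this]
  simp only [id] at hx'
  rw [hx, hx'] at h1
  refine ⟨lineEquiv.symm x, ?_⟩
  rw [permCongr_apply] at hx
  rw [eq_symm_apply, hx]
  omega

/-- The square of an automorphism of `H_2` is inner. -/
theorem exists_sq_eq_conj (φ : Houghton 2 ≃* Houghton 2) :
    ∃ u : Houghton 2, ∀ g, φ (φ g) = u * g * u⁻¹ := by
  obtain ⟨f, hf⟩ := exists_perm_forall_mulEquiv_apply swap_mem_houghton_two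
    (fun t ht h => exists_fixed_point_of_involution ht h) φ
  have hf' : ∀ g : Houghton 2, (φ.symm g : Perm (Fin 2 × ℕ)) = f⁻¹ * g * f := by
    intro g
    have := hf (φ.symm g)
    rw [MulEquiv.apply_symm_apply] at this
    rw [this]
    group
  have key : ∀ g : Houghton 2,
      IsTranslationNearEnds (lineEquiv.permCongrHom (g : Perm (Fin 2 × ℕ))) :=
    fun g => mem_houghton_two_iff.mp g.2
  have h1 := key (φ houghtonG2)
  have h2 := key (φ houghtonG2⁻¹)
  have h3 := key (φ.symm houghtonG2)
  have h4 := key (φ.symm houghtonG2⁻¹)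
  have e : lineEquiv.permCongrHom (houghtonG2 : Perm (Fin 2 × ℕ)) = Equiv.addRight (1 : ℤ) :=
    permCongrHom_translationPerm
  rw [hf, map_mul, map_mul, map_inv, e] at h1
  rw [hf, Subgroup.coe_inv, map_mul, map_mul, map_inv, map_inv, e] at h2
  rw [hf', map_mul, map_mul, map_inv, e] at h3
  rw [hf', Subgroup.coe_inv, map_mul, map_mul, map_inv, map_inv, e] at h4
  have h5 := isTranslationNearEnds_sq h1 h2 h3 h4
  rw [← map_mul] at h5
  refine ⟨⟨f * f, mem_houghton_two_iff.mpr h5⟩, fun g => Subtype.ext ?_⟩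
  rw [hf, hf]
  simp only [Subgroup.coe_mul, Subgroup.coe_inv]
  group

end Automorphisms

theorem mainTheorem6 :
    Subgroup.closure ({houghtonG2, houghtonAlpha} : Set (Houghton 2)) = ⊤ ∧
      ∀ (φ : Houghton 2 ≃* Houghton 2) (A : Set (Houghton 2)),
        A.Finite → Subgroup.closure A = ⊤ → growthRate A φ.toMonoidHom = 1 := by
  refine ⟨closure_houghtonG2_houghtonAlpha, fun φ A _ hA => ?_⟩
  have : Nontrivial (Houghton 2) := by
    refine ⟨houghtonAlpha, 1, fun h => ?_⟩
    have := congrArg Subtype.val h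
    exact absurd (Equiv.swap_eq_one_iff.mp this) (by decide)
  obtain ⟨u, hu⟩ := exists_sq_eq_conj φ
  exact growthRate_eq_one_of_linear_bound hA φ.toMonoidHom φ.injective
    (exists_linear_bound_of_sq_inner hA φ.toMonoidHom u hu)
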